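/- Let $\mathcal M$ be a finite von Neumann algebra with uniform norm $\|\cdot\|$, let $\tau$ be a faithful normal tracial state on $\mathcal M$, and let $1\le p\le\infty$. Put $\|x\|_p=\tau(|x|^p)^{1/p}$ for $x\in\mathcal M$ if $p<\infty$, and $\|x\|_\infty=\|x\|$. Let $\mathcal M_h$ be the real space of self-adjoint elements of $\mathcal M$ and let $\mathcal P\subset\mathcal M_h$ be the open cone of positive invertible elements. For $a\in\mathcal P$ and $x\in\mathcal M_h$ put $\|x\|_{a,p}=\|a^{-1/2}xa^{-1/2}\|_p$. A curve $\gamma:[0,1]\to\mathcal P$ is called piecewise smooth if it is continuous and $[0,1]$ can be subdivided into finitely many closed intervals on each of which $\gamma$ is $C^1$ (for the uniform norm) with nowhere vanishing derivative (one-sided at the end points). Its length is $\ell_p(\gamma)=\int_0^1\|\dot\gamma(t)\|_{\gamma(t),p}\,dt$. For $a,b\in\mathcal P$ let $d_p(a,b)$ be the infimum of the lengths of the piecewise smooth curves in $\mathcal P$ joining $a$ to $b$. **Theorem.** (1) Let $a,b\in\mathcal P$ and $\gamma_{a,b}(t)=a^{1/2}\,(a^{-1/2}\,b\,a^{-1/2})^{t}\,a^{1/2}$.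 Then $\gamma_{a,b}$ is a $C^1$ curve in $\mathcal P$, defined for all $t\in\mathbb R$, with $\gamma_{a,b}(0)=a$ and $\gamma_{a,b}(1)=b$; if $a\neq b$, its restriction to $[0,1]$ is a piecewise smooth curve joining $a$ to $b$ in the above sense (if $a=b$ it is constant). For every piecewise smooth curve $\beta$ in $\mathcal P$ joining $a$ to $b$, $\ell_p(\gamma_{a,b})\le\ell_p(\beta)$. (2) For all $v,w\in\mathcal M_h$, $$d_p(e^v,e^w)=\bigl\|\ln\bigl(e^{v/2}e^{-w}e^{v/2}\bigr)\bigr\|_p .$$ -/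

import Mathlib

open scoped ENNReal

noncomputable section

/-- `τ` is a faithful normal tracial state on the von Neumann algebra `M`.
(A von Neumann algebra that carries one is automatically finite: if `star u * u = 1`, then
`τ (1 - u * star u) = 0`, so that `u * star u = 1` by faithfulness.) -/
structure IsFaithfulNormalTracialState {M : Type*} [CStarAlgebra M] [PartialOrder M]
    [StarOrderedRing M] (τ : M →ₗ[ℂ] ℂ) : Prop where
  /-- positivity; `0 ≤ z` is spelled out as `0 ≤ z.re` and `z.im = 0` -/
  re_nonneg : ∀ x : M, 0 ≤ (τ (star x * x)).re
  im_eq_zero : ∀ x : M, (τ (star x * x)).im = 0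
  map_one : τ 1 = 1
  map_mul_comm : ∀ x y : M, τ (x * y) = τ (y * x)
  faithful : ∀ x : M, τ (star x * x) = 0 → x = 0
  /-- normality: `τ` preserves suprema of bounded upward directed sets of self-adjoint elements -/
  normal : ∀ (s : Set M) (x : M), s.Nonempty → (∀ y ∈ s, IsSelfAdjoint y) →
    DirectedOn (· ≤ ·) s → IsLUB s x → IsLUB ((fun y => (τ y).re) '' s) (τ x).re

section

variable {M : Type*} [CStarAlgebra M] [PartialOrder M] [StarOrderedRing M]

/-- The `p`-norm `‖x‖_p = τ(|x|^p)^{1/p}`, `1 ≤ p < ∞`; for `p = ∞` the uniform norm of `M`. -/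
def tracePNorm (τ : M →ₗ[ℂ] ℂ) (p : ℝ≥0∞) (x : M) : ℝ :=
  if p = ∞ then ‖x‖ else (τ (CFC.abs x ^ p.toReal)).re ^ (1 / p.toReal)

/-- The Finsler norm `‖x‖_{a,p} = ‖a^{-1/2} x a^{-1/2}‖_p` on the tangent space at `a`. -/
def finslerNorm (τ : M →ₗ[ℂ] ℂ) (p : ℝ≥0∞) (a x : M) : ℝ :=
  tracePNorm τ p (a ^ (-(1 / 2) : ℝ) * x * a ^ (-(1 / 2) : ℝ))

/-- The length `∫₀¹ ‖γ'(t)‖_{γ(t),p} dt` of a curve `γ : [0,1] → P`. The (nonnegative) integrand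
is integrated in `[0,∞]`; at the finitely many break points the value of `deriv` is irrelevant. -/
def finslerLength (τ : M →ₗ[ℂ] ℂ) (p : ℝ≥0∞) (γ : ℝ → M) : ℝ≥0∞ :=
  ∫⁻ t in Set.Icc (0 : ℝ) 1, ENNReal.ofReal (finslerNorm τ p (γ t) (deriv γ t))

/-- `γ` is smooth on `[s,t]`: it is `C¹` there for the uniform norm, with nonzero derivative
(one-sided at the end points). -/
def IsSmoothCurveOn (γ : ℝ → M) (s t : ℝ) : Prop :=
  ContDiffOn ℝ 1 γ (Set.Icc s t) ∧ ∀ r ∈ Set.Icc s t, derivWithin γ (Set.Icc s t) r ≠ 0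

/-- `γ` is piecewise smooth on `[0,1]`: it is continuous and there is a subdivision
`0 = s 0 < s 1 < ⋯ < s n = 1` such that `γ` is smooth on each `[s i, s (i + 1)]`. -/
def IsPiecewiseSmooth (γ : ℝ → M) : Prop :=
  ContinuousOn γ (Set.Icc 0 1) ∧
    ∃ (n : ℕ) (s : ℕ → ℝ), s 0 = 0 ∧ s n = 1 ∧
      ∀ i < n, s i < s (i + 1) ∧ IsSmoothCurveOn γ (s i) (s (i + 1))

/-- `γ` restricts to a piecewise smooth curve `[0,1] → P` joining `a` to `b`, where `P` is the cone
of positive invertible elements of `M`. -/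
structure IsCurveJoining (γ : ℝ → M) (a b : M) : Prop where
  mem_cone : ∀ t ∈ Set.Icc (0 : ℝ) 1, IsStrictlyPositive (γ t)
  piecewiseSmooth : IsPiecewiseSmooth γ
  left : γ 0 = a
  right : γ 1 = b

/-- The geodesic distance `d_p(a,b)`: the infimum of the lengths of the piecewise smooth curves in
the cone that join `a` to `b`. -/
def finslerDist (τ : M →ₗ[ℂ] ℂ) (p : ℝ≥0∞) (a b : M) : ℝ≥0∞ :=
  ⨅ (γ : ℝ → M) (_ : IsCurveJoining γ a b), finslerLength τ p γ

/-- The curve `γ_{a,b}(t) = a^{1/2} (a^{-1/2} b a^{-1/2})^t a^{1/2}`. -/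
def coneGeodesic (a b : M) (t : ℝ) : M :=
  a ^ (1 / 2 : ℝ) * (a ^ (-(1 / 2) : ℝ) * b * a ^ (-(1 / 2) : ℝ)) ^ t * a ^ (1 / 2 : ℝ)

end

end

/-- A tracial state, seen through its real part, as a bounded real functional. -/
structure IsRealTrace {M : Type*} [CStarAlgebra M] [PartialOrder M] (ρ : M →L[ℝ] ℝ) : Prop where
  nonneg : ∀ x : M, 0 ≤ x → 0 ≤ ρ x
  map_one : ρ 1 = 1
  map_mul_comm : ∀ x y : M, ρ (x * y) = ρ (y * x)

section Trace

variable {M : Type*} [CStarAlgebra M] [PartialOrder M] [StarOrderedRing M]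

theorem IsFaithfulNormalTracialState.exists_realTrace {τ : M →ₗ[ℂ] ℂ}
    (hτ : IsFaithfulNormalTracialState τ) :
    ∃ ρ : M →L[ℝ] ℝ, IsRealTrace ρ ∧ ∀ x, ρ x = (τ x).re := by
  open ComplexOrder in
  have hpos : ∀ x : M, 0 ≤ x → 0 ≤ τ x := by
    intro x hx
    obtain ⟨b, rfl⟩ := CStarAlgebra.nonneg_iff_eq_star_mul_self.1 hx
    exact Complex.nonneg_iff.2 ⟨hτ.re_nonneg b, (hτ.im_eq_zero b).symm⟩
  obtain ⟨C, hC⟩ := (PositiveLinearMap.mk₀ τ hpos).exists_norm_apply_le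
  refine ⟨LinearMap.mkContinuous (Complex.reLm ∘ₗ τ.restrictScalars ℝ) C fun x => ?_, ?_, ?_⟩
  · exact (Complex.abs_re_le_norm _).trans (hC x)
  · constructor
    · intro x hx
      exact (Complex.nonneg_iff.1 (hpos x hx)).1
    · change (τ 1).re = 1
      rw [hτ.map_one, Complex.one_re]
    · intro x y
      change (τ (x * y)).re = (τ (y * x)).re
      rw [hτ.map_mul_comm x y]
  · intro x
    rfl

theorem CFC.abs_rpow_eq_cfc {x : M} (hx : IsSelfAdjoint x) {r : ℝ} (hr : 0 ≤ r) :
    CFC.abs x ^ r = cfc (fun u : ℝ => |u| ^ r) x := by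
  rw [CFC.rpow_eq_cfc_real (CFC.abs_nonneg x), CFC.abs_eq_cfc_norm x hx,
    ← cfc_comp' (fun u : ℝ => u ^ r) (fun u : ℝ => ‖u‖) x
      ((Real.continuous_rpow_const hr).continuousOn)]
  rfl

variable {ρ : M →L[ℝ] ℝ}

namespace IsRealTrace

theorem mul_nonneg (hρ : IsRealTrace ρ) {x y : M} (hx : 0 ≤ x) (hy : 0 ≤ y) : 0 ≤ ρ (x * y) := by
  obtain ⟨b, rfl⟩ := CStarAlgebra.nonneg_iff_eq_star_mul_self.1 hx
  rw [mul_assoc, hρ.map_mul_comm]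
  exact hρ.nonneg _ (star_right_conjugate_nonneg hy b)

theorem mono (hρ : IsRealTrace ρ) {x y : M} (h : x ≤ y) : ρ x ≤ ρ y := by
  have := hρ.nonneg _ (sub_nonneg.2 h)
  rw [map_sub] at this
  linarith

/-- An operator inequality `0 ≤ ∑ α i u • X i`, valid for all scalars `u`, may be evaluated at a
self-adjoint element under a trace. -/
theorem sum_cfc_mul_nonneg (hρ : IsRealTrace ρ) {ι : Type*} [Fintype ι] {c : M}
    (α : ι → ℝ → ℝ) (hα : ∀ i, Continuous (α i)) (X : ι → M)
    (h : ∀ u : ℝ, 0 ≤ ∑ i, α i u • X i) : 0 ≤ ρ (∑ i, cfc (α i) c * X i) := by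
  set R : ℝ := ‖c‖ + 1 with hR
  have hRpos : 0 < R := by positivity
  have hspec : ∀ x ∈ spectrum ℝ c, |x| ≤ R := by
    intro x hx
    have := spectrum.norm_le_norm_mul_of_mem hx
    rcases subsingleton_or_nontrivial M with hM | hM
    · simp [spectrum.of_subsingleton] at hx
    · rw [CStarRing.norm_one, mul_one, Real.norm_eq_abs] at this
      linarith
  let s : ℝ → unitInterval := fun x => Set.projIcc 0 1 zero_le_one ((x + R) / (2 * R))
  have hs : Continuous s := by fun_prop
  let f : ι → C(unitInterval, ℝ) := fun i =>
    ⟨fun y => α i (2 * R * y - R), (hα i).comp (by fun_prop)⟩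
  have hfs : ∀ i, ∀ x ∈ spectrum ℝ c, f i (s x) = α i x := by
    intro i x hx
    have hx' := abs_le.1 (hspec x hx)
    have : (s x : ℝ) = (x + R) / (2 * R) := by
      have hmem : (x + R) / (2 * R) ∈ Set.Icc (0 : ℝ) 1 := by
        constructor
        · apply div_nonneg <;> linarith
        · rw [div_le_one (by positivity)]
          linarith
      exact congrArg Subtype.val (Set.projIcc_of_mem zero_le_one hmem)
    change α i (2 * R * (s x : ℝ) - R) = α i x
    rw [this]
    congr 1
    field_simp
    ring
  let F : ℕ → ι → ℝ → ℝ := fun n i x => bernsteinApproximation n (f i) (s x)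
  have hF : ∀ i, Filter.Tendsto (fun n => cfc (F n i) c) Filter.atTop (nhds (cfc (α i) c)) := by
    intro i
    refine tendsto_cfc_fun ?_ (Filter.Eventually.of_forall fun n =>
      ((bernsteinApproximation n (f i)).continuous.comp hs).continuousOn)
    have h1 := ContinuousMap.tendsto_iff_tendstoUniformly.1 (bernsteinApproximation_uniform (f i))
    have h2 := (h1.comp s).tendstoUniformlyOn (s := spectrum ℝ c)
    exact h2.congr_right fun x hx => hfs i x hx
  have hlim : Filter.Tendsto (fun n => ρ (∑ i, cfc (F n i) c * X i)) Filter.atTop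
      (nhds (ρ (∑ i, cfc (α i) c * X i))) :=
    (ρ.continuous.tendsto _).comp (tendsto_finsetSum _ fun i _ => (hF i).mul_const _)
  refine ge_of_tendsto' hlim fun n => ?_
  have hcont : ∀ k : Fin (n + 1), Continuous fun x => bernstein n k (s x) := fun k =>
    (bernstein n k).continuous.comp hs
  have hexp : ∀ i, cfc (F n i) c =
      ∑ k : Fin (n + 1), (f i (bernstein.z k)) • cfc (fun x => bernstein n k (s x)) c := by
    intro i
    have : F n i = ∑ k : Fin (n + 1), fun x => f i (bernstein.z k) * bernstein n k (s x) := by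
      ext x
      simp only [F, bernsteinApproximation.apply, Finset.sum_apply, smul_eq_mul, mul_comm]
    rw [this, cfc_sum _ _ _ fun k _ => ((hcont k).const_mul _).continuousOn]
    exact Finset.sum_congr rfl fun k _ => cfc_const_mul _ _ _ (hcont k).continuousOn
  have hsum : ∑ i, cfc (F n i) c * X i = ∑ k : Fin (n + 1),
      cfc (fun x => bernstein n k (s x)) c * ∑ i, f i (bernstein.z k) • X i := by
    simp_rw [hexp, Finset.sum_mul, Finset.mul_sum]
    rw [Finset.sum_comm]
    simp
  rw [hsum, map_sum]
  refine Finset.sum_nonneg fun k _ => hρ.mul_nonneg (cfc_nonneg fun x _ => bernstein_nonneg) ?_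
  exact h _

end IsRealTrace

/-- A unital positive trace preserving map. -/
structure IsDoublyStochastic (ρ : M →L[ℝ] ℝ) (T : M →ₗ[ℝ] M) : Prop where
  nonneg : ∀ x : M, 0 ≤ x → 0 ≤ T x
  map_one : T 1 = 1
  trace_map : ∀ x : M, ρ (T x) = ρ x

theorem IsDoublyStochastic.mono {T : M →ₗ[ℝ] M} (hT : IsDoublyStochastic ρ T) {x y : M}
    (h : x ≤ y) : T x ≤ T y := by
  have := hT.nonneg _ (sub_nonneg.2 h)
  rwa [map_sub, sub_nonneg] at this

theorem IsDoublyStochastic.norm_map_le {T : M →ₗ[ℝ] M} (hT : IsDoublyStochastic ρ T) {x : M}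
    (hx : IsSelfAdjoint x) : ‖T x‖ ≤ ‖x‖ := by
  have hone : ∀ r : ℝ, T (algebraMap ℝ M r) = algebraMap ℝ M r := fun r => by
    rw [Algebra.algebraMap_eq_smul_one, map_smul, hT.map_one]
  have h1 := hT.mono (hx.le_algebraMap_norm_self)
  have h2 := hT.mono (hx.neg_algebraMap_norm_le_self)
  rw [map_neg, hone] at h2
  rw [hone] at h1
  have hsa : IsSelfAdjoint (T x) := by
    have := (sub_nonneg.2 h1).isSelfAdjoint
    have h3 : IsSelfAdjoint (algebraMap ℝ M ‖x‖) := IsSelfAdjoint.algebraMap M (.all _)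
    simpa using h3.sub this
  conv_lhs => rw [← cfc_id ℝ (T x) hsa]
  refine norm_cfc_le (norm_nonneg x) fun r hr => ?_
  rw [← map_neg] at h2
  exact abs_le.2 ⟨(algebraMap_le_iff_le_spectrum hsa).1 h2 r hr,
    (le_algebraMap_iff_spectrum_le hsa).1 h1 r hr⟩

namespace IsRealTrace

/-- Young's inequality for a trace. -/
theorem mul_map_le_young (hρ : IsRealTrace ρ) {T : M →ₗ[ℝ] M} (hT : IsDoublyStochastic ρ T)
    {p q : ℝ} (hpq : p.HolderConjugate q) {c z : M} (hc : IsSelfAdjoint c)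
    (hz : IsSelfAdjoint z) :
    ρ (c * T z) ≤ ρ (cfc (fun u : ℝ => |u| ^ p) z) / p + ρ (cfc (fun u : ℝ => |u| ^ q) c) / q := by
  have hcp : Continuous fun u : ℝ => |u| ^ p := by
    have := hpq.nonneg
    fun_prop (disch := assumption)
  have hcq : Continuous fun u : ℝ => |u| ^ q := by
    have := hpq.symm.nonneg
    fun_prop (disch := assumption)
  have key := hρ.sum_cfc_mul_nonneg (ι := Fin 3) (c := c)
    ![fun _ => 1, fun u => u, fun u => |u| ^ q]
    (by intro i; fin_cases i; exacts [continuous_const, continuous_id, hcq])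
    ![p⁻¹ • T (cfc (fun u : ℝ => |u| ^ p) z), -T z, q⁻¹ • 1] (fun u => by
      have : 0 ≤ T (cfc (fun t : ℝ => p⁻¹ * |t| ^ p + (- u * t + q⁻¹ * |u| ^ q)) z) := by
        refine hT.nonneg _ (cfc_nonneg fun t _ => ?_)
        have := Real.young_inequality t u hpq
        rw [div_eq_inv_mul, div_eq_inv_mul] at this
        linarith
      rw [cfc_add (a := z) (fun t : ℝ => p⁻¹ * |t| ^ p) (fun t => - u * t + q⁻¹ * |u| ^ q)
          (hcp.const_mul p⁻¹).continuousOn (by fun_prop),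
        cfc_const_mul _ _ _ hcp.continuousOn, cfc_add_const (q⁻¹ * |u| ^ q) (fun t => -u * t) z (by fun_prop),
        cfc_const_mul_id (-u) z, Algebra.algebraMap_eq_smul_one, map_add, map_add, map_smul, map_smul,
        map_smul, hT.map_one] at this
      simp only [Fin.sum_univ_three, Matrix.cons_val_zero, Matrix.cons_val_one, Matrix.cons_val,
        smul_neg, smul_smul, one_mul]
      rw [mul_comm q⁻¹, neg_smul] at this
      rwa [add_assoc])
  simp only [Fin.sum_univ_three, Matrix.cons_val_zero, Matrix.cons_val_one, Matrix.cons_val,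
    cfc_const_one ℝ c, cfc_id' ℝ c, one_mul, mul_neg, mul_smul_comm, mul_one, map_add, map_neg,
    map_smul, smul_eq_mul, hT.trace_map] at key
  rw [div_eq_inv_mul, div_eq_inv_mul]
  linarith

theorem mul_map_le_abs (hρ : IsRealTrace ρ) {T : M →ₗ[ℝ] M} (hT : IsDoublyStochastic ρ T)
    {c z : M} (hc₁ : c ≤ 1) (hc₂ : -1 ≤ c) (hz : IsSelfAdjoint z) :
    ρ (c * T z) ≤ ρ (CFC.abs z) := by
  have h1 : 0 ≤ T (CFC.abs z - z) := by
    refine hT.nonneg _ ?_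
    rw [CFC.abs_sub_self z hz]
    exact nsmul_nonneg (CFC.negPart_nonneg z) 2
  have h2 : 0 ≤ T (CFC.abs z + z) := by
    refine hT.nonneg _ ?_
    rw [CFC.abs_add_self z hz]
    exact nsmul_nonneg (CFC.posPart_nonneg z) 2
  have h3 := hρ.mul_nonneg (sub_nonneg.2 hc₂) h1
  have h4 := hρ.mul_nonneg (sub_nonneg.2 hc₁) h2
  simp only [map_add, map_sub, sub_mul, add_mul, mul_add, mul_sub, one_mul, hT.trace_map,
    sub_neg_eq_add] at h3 h4
  linarith

end IsRealTrace

/-- The bounded functional `x ↦ r * ρ (c * x)`. -/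
noncomputable def traceMulLeft (ρ : M →L[ℝ] ℝ) (r : ℝ) (c : M) : M →L[ℝ] ℝ :=
  r • ρ.comp (ContinuousLinearMap.mul ℝ M c)

omit [PartialOrder M] [StarOrderedRing M] in
theorem traceMulLeft_apply (r : ℝ) (c x : M) : traceMulLeft ρ r c x = r * ρ (c * x) := rfl

theorem IsRealTrace.exists_dual_one (hρ : IsRealTrace ρ) {v : M} (hv : IsSelfAdjoint v) {ε : ℝ}
    (hε : 0 < ε) :
    ∃ φ : M →L[ℝ] ℝ, ρ (CFC.abs v) - ε ≤ φ v ∧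
      ∀ T : M →ₗ[ℝ] M, IsDoublyStochastic ρ T → ∀ z, IsSelfAdjoint z →
        φ (T z) ≤ ρ (CFC.abs z) := by
  let f : ℝ → ℝ := fun u => max (-1) (min 1 (u / ε))
  have hf : Continuous f := by fun_prop
  refine ⟨traceMulLeft ρ 1 (cfc f v), ?_, fun T hT z hz => ?_⟩
  · rw [traceMulLeft_apply, one_mul, sub_le_iff_le_add]
    have h1 : CFC.abs v ≤ cfc (fun u => f u * u + ε) v := by
      rw [CFC.abs_eq_cfc_norm v hv]
      refine cfc_mono fun u _ => ?_
      rw [Real.norm_eq_abs]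
      rcases le_total |u / ε| 1 with h | h
      · have h' := abs_le.1 h
        simp only [f]
        rw [min_eq_right h'.2, max_eq_right h'.1]
        rw [abs_div, abs_of_pos hε, div_le_one hε] at h
        have : 0 ≤ u / ε * u := by
          rw [div_mul_eq_mul_div]
          exact div_nonneg (mul_self_nonneg u) hε.le
        linarith
      · rcases le_total 0 u with hu | hu
        · rw [abs_of_nonneg (div_nonneg hu hε.le)] at h
          simp only [f]
          rw [min_eq_left h, max_eq_right (by norm_num), abs_of_nonneg hu]
          linarith
        · rw [abs_of_nonpos (div_nonpos_of_nonpos_of_nonneg hu hε.le)] at h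
          simp only [f]
          rw [min_eq_right (by linarith), max_eq_left (by linarith), abs_of_nonpos hu]
          linarith
    have h2 := hρ.mono h1
    rw [cfc_add_const _ _ _ (by fun_prop), cfc_mul _ _ _ (by fun_prop) (by fun_prop), cfc_id' ℝ v,
      Algebra.algebraMap_eq_smul_one, map_add, map_smul, hρ.map_one, smul_eq_mul, mul_one] at h2
    exact h2
  · rw [traceMulLeft_apply, one_mul]
    refine hρ.mul_map_le_abs hT ?_ ?_ hz
    · exact cfc_le_one f v fun u _ => max_le (by norm_num) (min_le_left _ _)
    · rw [← _root_.map_one (algebraMap ℝ M), ← map_neg]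
      exact algebraMap_le_cfc f _ v (fun u _ => le_max_left _ _)

theorem IsRealTrace.rpow_nonneg (hρ : IsRealTrace ρ) (p : ℝ) (x : M) :
    0 ≤ ρ (cfc (fun u : ℝ => |u| ^ p) x) :=
  hρ.nonneg _ (cfc_nonneg fun u _ => Real.rpow_nonneg (abs_nonneg u) p)

theorem IsRealTrace.exists_dual_of_one_lt (hρ : IsRealTrace ρ) {p : ℝ} (hp : 1 < p) {v : M}
    (hv : IsSelfAdjoint v) :
    ∃ φ : M →L[ℝ] ℝ, ρ (cfc (fun u : ℝ => |u| ^ p) v) ^ (1 / p) ≤ φ v ∧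
      ∀ T : M →ₗ[ℝ] M, IsDoublyStochastic ρ T → ∀ z, IsSelfAdjoint z →
        φ (T z) ≤ ρ (cfc (fun u : ℝ => |u| ^ p) z) ^ (1 / p) := by
  obtain ⟨q, hpq⟩ : ∃ q, p.HolderConjugate q := ⟨_, .conjExponent hp⟩
  have hp0 : 0 < p := hpq.pos
  set n : ℝ := ρ (cfc (fun u : ℝ => |u| ^ p) v) ^ (1 / p) with hn
  have hn0 : 0 ≤ n := Real.rpow_nonneg (hρ.rpow_nonneg p v) _
  have hnp : ρ (cfc (fun u : ℝ => |u| ^ p) v) = n ^ p := by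
    rw [hn, ← Real.rpow_mul (hρ.rpow_nonneg p v), one_div_mul_cancel hp0.ne', Real.rpow_one]
  rcases hn0.eq_or_lt with h0 | hnpos
  · exact ⟨0, h0.symm.le, fun T hT z hz => Real.rpow_nonneg (hρ.rpow_nonneg p z) _⟩
  have hp1 : 0 < p - 1 := sub_pos.2 hp
  let f : ℝ → ℝ := fun u => max u 0 ^ (p - 1) - max (-u) 0 ^ (p - 1)
  have hf : Continuous f := by
    have := hp1.le
    fun_prop (disch := assumption)
  have hfpos : ∀ u, 0 ≤ u → f u = |u| ^ (p - 1) := by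
    intro u hu
    simp only [f]
    rw [max_eq_left hu, max_eq_right (by linarith), Real.zero_rpow hp1.ne', sub_zero,
      abs_of_nonneg hu]
  have hfneg : ∀ u, u ≤ 0 → f u = -|u| ^ (p - 1) := by
    intro u hu
    simp only [f]
    rw [max_eq_right hu, max_eq_left (by linarith), Real.zero_rpow hp1.ne', zero_sub,
      abs_of_nonpos hu]
  have hfabs : ∀ u, |f u| ^ q = |u| ^ p := by
    intro u
    have : |f u| = |u| ^ (p - 1) := by
      rcases le_total 0 u with hu | hu
      · rw [hfpos u hu, abs_of_nonneg (by positivity)]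
      · rw [hfneg u hu, abs_neg, abs_of_nonneg (by positivity)]
    rw [this, ← Real.rpow_mul (abs_nonneg u), hpq.sub_one_mul_conj]
  have hfmul : ∀ u, f u * u = |u| ^ p := by
    intro u
    have : |u| ^ p = |u| ^ (p - 1) * |u| := by
      rcases eq_or_ne u 0 with rfl | hu
      · simp [hp0.ne']
      · rw [← Real.rpow_add_one (abs_ne_zero.2 hu), sub_add_cancel]
    rw [this]
    rcases le_total 0 u with hu | hu
    · rw [hfpos u hu, abs_of_nonneg hu]
    · rw [hfneg u hu, abs_of_nonpos hu]
      ring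
  have hc : IsSelfAdjoint (cfc f v) := cfc_predicate f v
  have hcv : ρ (cfc f v * v) = n ^ p := by
    have h := cfc_mul f (fun u => u) v hf.continuousOn continuous_id.continuousOn
    rw [cfc_id' ℝ v] at h
    rw [← hnp, ← h]
    simp_rw [hfmul]
  have hcontq : Continuous fun u : ℝ => |u| ^ q := by
    have := hpq.symm.nonneg
    fun_prop (disch := assumption)
  have hcontp : Continuous fun u : ℝ => |u| ^ p := by
    fun_prop (disch := exact hp0.le)
  have hcq : ρ (cfc (fun u : ℝ => |u| ^ q) (cfc f v)) = n ^ p := by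
    rw [← hnp, ← cfc_comp' (fun u : ℝ => |u| ^ q) f v hcontq.continuousOn hf.continuousOn hv]
    simp_rw [hfabs]
  have hnsplit : n ^ p = n ^ (p - 1) * n := by
    rw [← Real.rpow_add_one hnpos.ne', sub_add_cancel]
  have hn1 : 0 < n ^ (p - 1) := Real.rpow_pos_of_pos hnpos _
  refine ⟨traceMulLeft ρ (n ^ (p - 1))⁻¹ (cfc f v), ?_, fun T hT z hz => ?_⟩
  · rw [traceMulLeft_apply, hcv, hnsplit, inv_mul_cancel_left₀ hn1.ne']
  · set m : ℝ := ρ (cfc (fun u : ℝ => |u| ^ p) z) ^ (1 / p) with hm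
    have hm0 : 0 ≤ m := Real.rpow_nonneg (hρ.rpow_nonneg p z) _
    have hmp : ρ (cfc (fun u : ℝ => |u| ^ p) z) = m ^ p := by
      rw [hm, ← Real.rpow_mul (hρ.rpow_nonneg p z), one_div_mul_cancel hp0.ne', Real.rpow_one]
    refine le_of_forall_gt_imp_ge_of_dense fun m' hm' => ?_
    have hm'0 : 0 < m' := hm0.trans_lt hm'
    set r : ℝ := n / m' with hr
    have hr0 : 0 < r := div_pos hnpos hm'0
    have hrz : IsSelfAdjoint (r • z) := IsSelfAdjoint.smul (.all r) hz
    have hy := hρ.mul_map_le_young hT hpq hc hrz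
    have hscale : ρ (cfc (fun u : ℝ => |u| ^ p) (r • z)) = r ^ p * m ^ p := by
      rw [← cfc_comp_smul r (fun u : ℝ => |u| ^ p) z hcontp.continuousOn hz]
      simp_rw [smul_eq_mul, abs_mul, abs_of_pos hr0, Real.mul_rpow hr0.le (abs_nonneg _)]
      rw [cfc_const_mul _ _ _ hcontp.continuousOn, map_smul, hmp, smul_eq_mul]
    rw [hscale, hcq, map_smul, mul_smul_comm, map_smul, smul_eq_mul] at hy
    have hle : r ^ p * m ^ p ≤ n ^ p := by
      rw [← Real.mul_rpow hr0.le hm0]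
      refine Real.rpow_le_rpow (by positivity) ?_ hp0.le
      rw [hr, div_mul_eq_mul_div, div_le_iff₀ hm'0]
      exact mul_le_mul_of_nonneg_left hm'.le hn0
    have hsum : n ^ p / p + n ^ p / q = n ^ p := by
      rw [div_eq_mul_inv, div_eq_mul_inv, ← mul_add, hpq.inv_add_inv_eq_one, mul_one]
    have hfin : r * ρ (cfc f v * T z) ≤ n ^ p := by
      have := div_le_div_of_nonneg_right hle hp0.le
      linarith
    rw [traceMulLeft_apply, inv_mul_le_iff₀ hn1]
    rw [hr, div_mul_eq_mul_div, div_le_iff₀ hm'0, hnsplit] at hfin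
    nlinarith

/-- Functionals norming a self-adjoint element whose composition with every doubly stochastic map
is dominated by the `p`-norm. -/
theorem IsRealTrace.exists_dual (hρ : IsRealTrace ρ) {τ : M →ₗ[ℂ] ℂ} (hτ : ∀ x, ρ x = (τ x).re)
    {p : ℝ≥0∞} (hp : 1 ≤ p) {v : M} (hv : IsSelfAdjoint v) {ε : ℝ} (hε : 0 < ε) :
    ∃ φ : M →L[ℝ] ℝ, tracePNorm τ p v - ε ≤ φ v ∧
      ∀ T : M →ₗ[ℝ] M, IsDoublyStochastic ρ T → ∀ z, IsSelfAdjoint z →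
        φ (T z) ≤ tracePNorm τ p z := by
  rcases eq_or_ne p ∞ with rfl | hp_top
  · obtain ⟨g, hg, hgv⟩ := exists_dual_vector'' ℝ v
    refine ⟨g, ?_, fun T hT z hz => ?_⟩
    · rw [hgv]
      simp [tracePNorm, hε.le]
    · simp only [tracePNorm, if_true]
      calc g (T z) ≤ ‖g (T z)‖ := Real.le_norm_self _
        _ ≤ 1 * ‖T z‖ := g.le_of_opNorm_le hg _
        _ ≤ ‖z‖ := by rw [one_mul]; exact hT.norm_map_le hz
  · have hp' : 1 ≤ p.toReal := by
      rw [← ENNReal.toReal_one]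
      exact ENNReal.toReal_mono hp_top hp
    rcases hp'.eq_or_lt with h1 | h1
    · have hN : ∀ x : M, tracePNorm τ p x = ρ (CFC.abs x) := fun x => by
        simp only [tracePNorm, if_neg hp_top, ← h1, hτ]
        rw [CFC.rpow_one _ (CFC.abs_nonneg x), one_div_one, Real.rpow_one]
      simp_rw [hN]
      exact hρ.exists_dual_one hv hε
    · have hN : ∀ x : M, IsSelfAdjoint x → tracePNorm τ p x =
          ρ (cfc (fun u : ℝ => |u| ^ p.toReal) x) ^ (1 / p.toReal) := fun x hx => by
        simp only [tracePNorm, if_neg hp_top, hτ,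
          CFC.abs_rpow_eq_cfc hx (zero_le_one.trans hp')]
      obtain ⟨φ, h2, h3⟩ := hρ.exists_dual_of_one_lt h1 hv
      refine ⟨φ, ?_, fun T hT z hz => ?_⟩
      · rw [hN v hv]
        linarith
      · rw [hN z hz]
        exact h3 T hT z hz

end Trace

section LogDerivative

open MeasureTheory

theorem HasDerivAt.ringInverse {M : Type*} [NormedRing M] [NormedAlgebra ℝ M] [CompleteSpace M]
    {f : ℝ → M} {f' : M} {t : ℝ} (hf : HasDerivAt f f' t) (hu : IsUnit (f t)) :
    HasDerivAt (fun s => Ring.inverse (f s)) (-(Ring.inverse (f t) * f' * Ring.inverse (f t))) t := by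
  obtain ⟨u, hu⟩ := hu
  have h := hasFDerivAt_ringInverse (𝕜 := ℝ) u
  rw [hu] at h
  have := h.comp_hasDerivAt t hf
  simpa [← hu, Function.comp_def] using this

variable {M : Type*} [CStarAlgebra M] [PartialOrder M] [StarOrderedRing M]

/-- The inverse of the convex combination `(1 - l) + l b`. -/
noncomputable def segmentInverse (l : ℝ) (b : M) : M := Ring.inverse ((1 - l) • 1 + l • b)

theorem IsStrictlyPositive.segment {b : M} (hb : IsStrictlyPositive b) {l : ℝ}
    (hl : l ∈ Set.Icc (0 : ℝ) 1) : IsStrictlyPositive ((1 - l) • (1 : M) + l • b) := by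
  rcases hl.2.eq_or_lt with rfl | h
  · simpa using hb
  · refine IsStrictlyPositive.add_nonneg ?_ (smul_nonneg hl.1 hb.nonneg)
    exact IsStrictlyPositive.smul (sub_pos.2 h) isStrictlyPositive_one

section

variable {b : M} (hb : IsStrictlyPositive b) {l : ℝ} (hl : l ∈ Set.Icc (0 : ℝ) 1)
include hb hl

theorem segmentInverse_mul : segmentInverse l b * ((1 - l) • 1 + l • b) = 1 :=
  Ring.inverse_mul_cancel _ (hb.segment hl).isUnit

theorem mul_segmentInverse : ((1 - l) • 1 + l • b) * segmentInverse l b = 1 :=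
  Ring.mul_inverse_cancel _ (hb.segment hl).isUnit

theorem isSelfAdjoint_segmentInverse : IsSelfAdjoint (segmentInverse l b) :=
  (hb.segment hl).ringInverse.isSelfAdjoint

theorem Commute.segmentInverse_right {x : M} (hx : Commute x b) :
    Commute x (segmentInverse l b) := by
  have h : Commute x ((1 - l) • 1 + l • b) :=
    ((Commute.one_right x).smul_right _).add_right (hx.smul_right _)
  calc x * segmentInverse l b
      = segmentInverse l b * ((1 - l) • 1 + l • b) * x * segmentInverse l b := by
        rw [segmentInverse_mul hb hl, one_mul]
    _ = segmentInverse l b * x := by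
        rw [mul_assoc (segmentInverse l b), ← h.eq, mul_assoc, mul_assoc, mul_segmentInverse hb hl,
          mul_one]

theorem hasDerivAt_segmentInverse :
    HasDerivAt (fun l => segmentInverse l b)
      (-(segmentInverse l b * (b - 1) * segmentInverse l b)) l := by
  have : HasDerivAt (fun l : ℝ => (1 - l) • (1 : M) + l • b) (b - 1) l := by
    have h1 := ((hasDerivAt_id l).const_sub 1).smul_const (1 : M)
    have h2 := (hasDerivAt_id l).smul_const b
    refine (h1.add h2).congr_deriv ?_
    rw [neg_smul, one_smul, one_smul, sub_eq_neg_add]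
  exact this.ringInverse (hb.segment hl).isUnit

theorem hasDerivAt_smul_segmentInverse :
    HasDerivAt (fun l => l • segmentInverse l b) (segmentInverse l b * segmentInverse l b) l := by
  have h := (hasDerivAt_id l).smul (hasDerivAt_segmentInverse hb hl)
  refine h.congr_deriv ?_
  have h1 : segmentInverse l b = segmentInverse l b * ((1 - l) • 1 + l • b) * segmentInverse l b := by
    rw [segmentInverse_mul hb hl, one_mul]
  rw [one_smul, id]
  nth_rewrite 3 [h1]
  simp only [mul_add, mul_sub, add_mul, sub_mul, mul_smul_comm, smul_mul_assoc, mul_one, smul_neg,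
    smul_sub, sub_smul, one_smul]
  abel

end

theorem continuousOn_segmentInverse :
    ContinuousOn (fun x : ℝ × M => segmentInverse x.1 x.2)
      (Set.Icc (0 : ℝ) 1 ×ˢ {b | IsStrictlyPositive b}) := by
  rintro ⟨l, b⟩ ⟨hl, hb⟩
  obtain ⟨u, hu⟩ := (IsStrictlyPositive.segment hb hl).isUnit
  have h := NormedRing.inverse_continuousAt u
  rw [hu] at h
  exact (ContinuousAt.comp (f := fun x : ℝ × M => (1 - x.1) • (1 : M) + x.1 • x.2) (x := (l, b)) h
    (by fun_prop)).continuousWithinAt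

theorem continuousOn_segmentInverse_left {b : M} (hb : IsStrictlyPositive b) :
    ContinuousOn (fun l : ℝ => segmentInverse l b) (Set.uIcc 0 1) := by
  rw [Set.uIcc_of_le zero_le_one]
  exact continuousOn_segmentInverse.comp (f := fun l : ℝ => (l, b)) (by fun_prop)
    fun l hl => ⟨hl, hb⟩

theorem integral_segmentInverse_mul_self {b : M} (hb : IsStrictlyPositive b) :
    ∫ l in (0 : ℝ)..1, segmentInverse l b * segmentInverse l b = Ring.inverse b := by
  have hc := continuousOn_segmentInverse_left hb
  rw [intervalIntegral.integral_eq_sub_of_hasDerivAt (f := fun l => l • segmentInverse l b)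
    (fun l hl => hasDerivAt_smul_segmentInverse hb (by rwa [Set.uIcc_of_le zero_le_one] at hl))
    (hc.mul hc).intervalIntegrable]
  simp [segmentInverse]

omit [PartialOrder M] [StarOrderedRing M] in
theorem intervalIntegral_mul_mul (a c : M) {f : ℝ → M} {s t : ℝ}
    (hf : IntervalIntegrable f volume s t) :
    ∫ l in s..t, a * f l * c = a * (∫ l in s..t, f l) * c :=
  (ContinuousLinearMap.mulLeftRight ℝ M a c).intervalIntegral_comp_comm hf

theorem integral_mul_segmentInverse_mul {b : M} (hb : IsStrictlyPositive b) (a c : M) :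
    ∫ l in (0 : ℝ)..1, a * (segmentInverse l b * segmentInverse l b) * c =
      a * Ring.inverse b * c := by
  have hc := continuousOn_segmentInverse_left hb
  rw [← integral_segmentInverse_mul_self hb]
  exact intervalIntegral_mul_mul a c (hc.mul hc).intervalIntegrable

/-- The derivative of the logarithm at `b`. -/
noncomputable def cfcLogDeriv (b x : M) : M :=
  ∫ l in (0 : ℝ)..1, segmentInverse l b * x * segmentInverse l b

/-- The logarithm, as an integral of resolvents. -/
noncomputable def logIntegral (b : M) : M := ∫ l in (0 : ℝ)..1, (b - 1) * segmentInverse l b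

theorem hasDerivAt_sub_one_mul_segmentInverse {b : ℝ → M} {b' : M} {t l : ℝ}
    (hl : l ∈ Set.Icc (0 : ℝ) 1) (hb : HasDerivAt b b' t) (hpos : IsStrictlyPositive (b t)) :
    HasDerivAt (fun t => (b t - 1) * segmentInverse l (b t))
      (segmentInverse l (b t) * b' * segmentInverse l (b t)) t := by
  have h1 := ((hb.const_smul l).const_add ((1 - l) • (1 : M))).ringInverse
    (hpos.segment hl).isUnit
  have h2 := (hb.sub_const 1).mul h1
  refine h2.congr_deriv ?_
  change b' * segmentInverse l (b t) + (b t - 1) * -(segmentInverse l (b t) * l • b' *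
    segmentInverse l (b t)) = _
  have h3 : segmentInverse l (b t) = 1 - l • ((b t - 1) * segmentInverse l (b t)) := by
    rw [eq_sub_iff_add_eq]
    refine Eq.trans ?_ (mul_segmentInverse hpos hl)
    simp only [add_mul, sub_mul, smul_mul_assoc, one_mul, smul_sub, sub_smul, one_smul]
    abel
  nth_rewrite 4 [h3]
  simp only [sub_mul, one_mul, mul_neg, mul_smul_comm, smul_mul_assoc, mul_assoc, smul_sub]
  abel

theorem logIntegral_sub {b b' : ℝ → M} {s t : ℝ} (hst : s ≤ t)
    (hb : ContinuousOn b (Set.Icc s t)) (hb' : ContinuousOn b' (Set.Icc s t))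
    (hderiv : ∀ r ∈ Set.Ioo s t, HasDerivAt b (b' r) r)
    (hpos : ∀ r ∈ Set.Icc s t, IsStrictlyPositive (b r)) :
    IntervalIntegrable (fun r => cfcLogDeriv (b r) (b' r)) volume s t ∧
    ∫ r in s..t, cfcLogDeriv (b r) (b' r) = logIntegral (b t) - logIntegral (b s) := by
  let f : ℝ → ℝ → M := fun l r => segmentInverse l (b r) * b' r * segmentInverse l (b r)
  have hR : ContinuousOn (fun x : ℝ × ℝ => segmentInverse x.1 (b x.2))
      (Set.Icc 0 1 ×ˢ Set.Icc s t) :=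
    continuousOn_segmentInverse.comp (f := fun x : ℝ × ℝ => (x.1, b x.2))
      (continuousOn_fst.prodMk (hb.comp continuousOn_snd fun x hx => hx.2))
      fun x hx => ⟨hx.1, hpos _ hx.2⟩
  have hf : ContinuousOn (Function.uncurry f) (Set.Icc 0 1 ×ˢ Set.Icc s t) :=
    (hR.mul (hb'.comp continuousOn_snd fun x hx => hx.2)).mul hR
  have hint : Integrable (Function.uncurry f)
      ((volume.restrict (Set.uIoc 0 1)).prod (volume.restrict (Set.Ioc s t))) := by
    rw [Measure.prod_restrict, Set.uIoc_of_le zero_le_one]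
    exact (hf.integrableOn_compact (isCompact_Icc.prod isCompact_Icc)).mono_set
      (Set.prod_mono Set.Ioc_subset_Icc_self Set.Ioc_subset_Icc_self)
  have hswap := MeasureTheory.intervalIntegral_integral_swap hint
  have hft : ∀ l ∈ Set.uIcc (0 : ℝ) 1, ∫ r in Set.Ioc s t, f l r =
      (b t - 1) * segmentInverse l (b t) - (b s - 1) * segmentInverse l (b s) := by
    intro l hl
    rw [Set.uIcc_of_le zero_le_one] at hl
    have hRl : ContinuousOn (fun r => segmentInverse l (b r)) (Set.Icc s t) :=
      hR.comp (f := fun r : ℝ => (l, r)) (by fun_prop) fun r hr => ⟨hl, hr⟩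
    rw [← intervalIntegral.integral_of_le hst]
    refine intervalIntegral.integral_eq_sub_of_hasDerivAt_of_le hst
      (f := fun r => (b r - 1) * segmentInverse l (b r)) ((hb.sub continuousOn_const).mul hRl)
      (fun r hr => hasDerivAt_sub_one_mul_segmentInverse hl (hderiv r hr)
        (hpos r (Set.Ioo_subset_Icc_self hr))) ?_
    refine ContinuousOn.intervalIntegrable ?_
    rw [Set.uIcc_of_le hst]
    exact (hRl.mul hb').mul hRl
  constructor
  · rw [intervalIntegrable_iff_integrableOn_Ioc_of_le hst]
    have := hint.integral_prod_right
    simp only [Function.uncurry] at this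
    rw [Set.uIoc_of_le zero_le_one] at this
    simp only [cfcLogDeriv, intervalIntegral.integral_of_le (zero_le_one (α := ℝ))]
    exact this
  · rw [intervalIntegral.integral_of_le hst]
    simp only [cfcLogDeriv]
    rw [← hswap, intervalIntegral.integral_congr (g := fun l =>
      (b t - 1) * segmentInverse l (b t) - (b s - 1) * segmentInverse l (b s)) hft,
      intervalIntegral.integral_sub]
    · rfl
    · exact (continuousOn_const.mul (continuousOn_segmentInverse_left
        (hpos t ⟨hst, le_rfl⟩))).intervalIntegrable
    · exact (continuousOn_const.mul (continuousOn_segmentInverse_left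
        (hpos s ⟨le_rfl, hst⟩))).intervalIntegrable

theorem IsSelfAdjoint.isStrictlyPositive_exp {v : M} (hv : IsSelfAdjoint v) :
    IsStrictlyPositive (NormedSpace.exp v) := by
  let _ : NormedAlgebra ℚ M := .restrictScalars ℚ ℝ M
  exact ⟨hv.exp_nonneg, NormedSpace.isUnit_exp v⟩

theorem logIntegral_exp {v : M} (hv : IsSelfAdjoint v) : logIntegral (NormedSpace.exp v) = v := by
  have hpos : ∀ t : ℝ, IsStrictlyPositive (NormedSpace.exp (t • v)) := fun t =>
    (IsSelfAdjoint.smul (.all t) hv).isStrictlyPositive_exp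
  have hd : ∀ t : ℝ, HasDerivAt (fun t : ℝ => NormedSpace.exp (t • v))
      (v * NormedSpace.exp (t • v)) t := fun t => hasDerivAt_exp_smul_const' v t
  have hcont : Continuous fun t : ℝ => NormedSpace.exp (t • v) :=
    continuous_iff_continuousAt.2 fun t => (hd t).continuousAt
  have h := (logIntegral_sub zero_le_one hcont.continuousOn
    (continuous_const.mul hcont).continuousOn (fun r _ => hd r) (fun r _ => hpos r)).2
  have hconst : ∀ r : ℝ, cfcLogDeriv (NormedSpace.exp (r • v)) (v * NormedSpace.exp (r • v)) = v := by
    intro r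
    set e := NormedSpace.exp (r • v) with he
    have hve : Commute v e := ((Commute.refl v).smul_right r).exp_right
    have hcm : Commute (v * e) e := hve.mul_left (Commute.refl e)
    have h1 : cfcLogDeriv e (v * e) =
        ∫ l in (0 : ℝ)..1, v * e * (segmentInverse l e * segmentInverse l e) * 1 := by
      refine intervalIntegral.integral_congr fun l hl => ?_
      rw [Set.uIcc_of_le zero_le_one] at hl
      rw [← (hcm.segmentInverse_right (hpos r) hl).eq, mul_assoc, mul_one]
    rw [h1, integral_mul_segmentInverse_mul (hpos r), mul_one,
      mul_assoc, Ring.mul_inverse_cancel _ (hpos r).isUnit, mul_one]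
  have h1 : logIntegral (1 : M) = 0 := by simp [logIntegral]
  change ∫ r in (0 : ℝ)..1, cfcLogDeriv (NormedSpace.exp (r • v)) (v * NormedSpace.exp (r • v)) =
    _ at h
  simp_rw [hconst] at h
  rw [intervalIntegral.integral_const, one_smul, zero_smul, NormedSpace.exp_zero, h1] at h
  simpa using h.symm

theorem logIntegral_eq_log {b : M} (hb : IsStrictlyPositive b) : logIntegral b = CFC.log b := by
  conv_lhs => rw [← CFC.exp_log b hb]
  exact logIntegral_exp .log

theorem continuousOn_cfcLogDeriv {b : M} (hb : IsStrictlyPositive b) (x : M) :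
    ContinuousOn (fun l => segmentInverse l b * x * segmentInverse l b) (Set.uIcc 0 1) :=
  have hc := continuousOn_segmentInverse_left hb
  (hc.mul continuousOn_const).mul hc

theorem IsUnit.isStrictlyPositive_mul_star {h : M} (hh : IsUnit h) :
    IsStrictlyPositive (h * star h) :=
  ⟨mul_star_self_nonneg h, hh.mul hh.star⟩

/-- The derivative of the logarithm at `h * star h`, precomposed with `z ↦ h * z * star h`. -/
noncomputable def logDerivConj (h : M) (hh : IsUnit h) : M →ₗ[ℝ] M where
  toFun z := cfcLogDeriv (h * star h) (h * z * star h)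
  map_add' x y := by
    have hb := hh.isStrictlyPositive_mul_star
    rw [cfcLogDeriv, cfcLogDeriv, cfcLogDeriv,
      ← intervalIntegral.integral_add (continuousOn_cfcLogDeriv hb _).intervalIntegrable
        (continuousOn_cfcLogDeriv hb _).intervalIntegrable]
    simp only [mul_add, add_mul]
  map_smul' r x := by
    rw [cfcLogDeriv, RingHom.id_apply, cfcLogDeriv, ← intervalIntegral.integral_smul]
    simp only [mul_smul_comm, smul_mul_assoc]

theorem isDoublyStochastic_logDerivConj {ρ : M →L[ℝ] ℝ} (hρ : IsRealTrace ρ) {h : M}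
    (hh : IsUnit h) : IsDoublyStochastic ρ (logDerivConj h hh) := by
  set b := h * star h with hb_def
  have hb : IsStrictlyPositive b := hh.isStrictlyPositive_mul_star
  have hc := continuousOn_segmentInverse_left hb
  constructor
  · intro x hx
    change 0 ≤ cfcLogDeriv b _
    rw [cfcLogDeriv, intervalIntegral.integral_of_le zero_le_one]
    refine integral_nonneg_of_ae ((ae_restrict_iff' measurableSet_Ioc).2 (.of_forall fun l hl => ?_))
    have hsa := isSelfAdjoint_segmentInverse hb (Set.Ioc_subset_Icc_self hl)
    change 0 ≤ segmentInverse l b * (h * x * star h) * segmentInverse l b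
    have := star_right_conjugate_nonneg (star_right_conjugate_nonneg hx h) (segmentInverse l b)
    rwa [hsa.star_eq] at this
  · change cfcLogDeriv b _ = 1
    have : cfcLogDeriv b (h * 1 * star h) =
        ∫ l in (0 : ℝ)..1, b * (segmentInverse l b * segmentInverse l b) * 1 := by
      refine intervalIntegral.integral_congr fun l hl => ?_
      rw [Set.uIcc_of_le zero_le_one] at hl
      rw [mul_one, mul_one, ← hb_def, ← ((Commute.refl b).segmentInverse_right hb hl).eq, mul_assoc]
    rw [this, integral_mul_segmentInverse_mul hb, mul_one,
      Ring.mul_inverse_cancel _ hb.isUnit]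
  · intro x
    change ρ (cfcLogDeriv b (h * x * star h)) = ρ x
    have h1 : ρ (cfcLogDeriv b (h * x * star h)) = ∫ l in (0 : ℝ)..1,
        ρ ((x * star h) * (segmentInverse l b * segmentInverse l b) * h) := by
      rw [cfcLogDeriv, ← ρ.intervalIntegral_comp_comm
        (continuousOn_cfcLogDeriv hb _).intervalIntegrable]
      refine intervalIntegral.integral_congr fun l _ => ?_
      change ρ (segmentInverse l b * (h * x * star h) * segmentInverse l b) = _
      rw [show segmentInverse l b * (h * x * star h) * segmentInverse l b =
        (segmentInverse l b * h) * (x * star h * segmentInverse l b) by simp only [mul_assoc],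
        hρ.map_mul_comm]
      simp only [mul_assoc]
    have hint : IntervalIntegrable (fun l => (x * star h) *
        (segmentInverse l b * segmentInverse l b) * h) volume 0 1 :=
      ((continuousOn_const.mul (hc.mul hc)).mul continuousOn_const).intervalIntegrable
    have h2 : star h * Ring.inverse b * h = 1 := by
      obtain ⟨u, rfl⟩ := hh
      have : b = ((u * star u : Mˣ) : M) := by simp [hb_def]
      rw [this, Ring.inverse_unit, mul_inv_rev, Units.val_mul, ← Units.coe_star, ← mul_assoc,
        ← Units.val_mul, mul_inv_cancel, Units.val_one, one_mul, ← Units.val_mul, inv_mul_cancel,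
        Units.val_one]
    rw [h1, ρ.intervalIntegral_comp_comm hint, integral_mul_segmentInverse_mul hb, mul_assoc, mul_assoc, ← mul_assoc (star h), h2, mul_one]

end LogDerivative

section Length

open MeasureTheory

theorem MeasureTheory.ofReal_integral_le_lintegral {α : Type*} [MeasurableSpace α] {μ : Measure α}
    {f : α → ℝ} (hf : Integrable f μ) :
    ENNReal.ofReal (∫ x, f x ∂μ) ≤ ∫⁻ x, ENNReal.ofReal (f x) ∂μ := by
  rw [integral_eq_lintegral_pos_part_sub_lintegral_neg_part hf]
  exact (ENNReal.ofReal_le_ofReal (sub_le_self _ ENNReal.toReal_nonneg)).trans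
    ENNReal.ofReal_toReal_le

theorem HasDerivAt.isSelfAdjoint_of_eventually {E : Type*} [NormedAddCommGroup E] [NormedSpace ℝ E]
    [StarAddMonoid E] [ContinuousStar E] [StarModule ℝ E] {f : ℝ → E} {f' : E} {t : ℝ}
    (hf : HasDerivAt f f' t) (hsa : ∀ᶠ s in nhds t, IsSelfAdjoint (f s)) : IsSelfAdjoint f' :=
  (hf.star.congr_of_eventuallyEq (hsa.mono fun _ hs => hs.symm)).unique hf

variable {M : Type*} [CStarAlgebra M] [PartialOrder M] [StarOrderedRing M]

theorem IsStrictlyPositive.rpow_half_mul_self {a : M} (ha : IsStrictlyPositive a) :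
    a ^ (1 / 2 : ℝ) * a ^ (1 / 2 : ℝ) = a := by
  rw [← CFC.rpow_add ha.isUnit, add_halves, CFC.rpow_one a ha.nonneg]

theorem IsStrictlyPositive.conj {a g : M} (ha : IsStrictlyPositive a) (hg : IsSelfAdjoint g)
    (hgu : IsUnit g) : IsStrictlyPositive (g * a * g) := by
  refine ⟨?_, (hgu.mul ha.isUnit).mul hgu⟩
  simpa [hg.star_eq] using star_left_conjugate_nonneg ha.nonneg g

/-- Along a smooth piece, a functional of the logarithm of a congruent curve grows at most by the
length of the curve. -/
theorem ofReal_log_sub_log_le_lintegral {ρ : M →L[ℝ] ℝ} (hρ : IsRealTrace ρ) {τ : M →ₗ[ℂ] ℂ}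
    {p : ℝ≥0∞} {φ : M →L[ℝ] ℝ}
    (hφ : ∀ T : M →ₗ[ℝ] M, IsDoublyStochastic ρ T → ∀ z, IsSelfAdjoint z →
      φ (T z) ≤ tracePNorm τ p z) {g : M} (hg : IsSelfAdjoint g) (hgu : IsUnit g) {β : ℝ → M}
    {s t : ℝ} (hst : s < t) (hβ : IsSmoothCurveOn β s t)
    (hpos : ∀ r ∈ Set.Icc s t, IsStrictlyPositive (β r)) :
    ENNReal.ofReal (φ (CFC.log (g * β t * g)) - φ (CFC.log (g * β s * g))) ≤
      ∫⁻ r in Set.Ioc s t, ENNReal.ofReal (finslerNorm τ p (β r) (deriv β r)) := by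
  set β' : ℝ → M := derivWithin β (Set.Icc s t) with hβ'
  have hcβ' : ContinuousOn β' (Set.Icc s t) :=
    hβ.1.continuousOn_derivWithin (uniqueDiffOn_Icc hst) le_rfl
  have hderiv : ∀ r ∈ Set.Ioo s t, HasDerivAt β (β' r) r := fun r hr =>
    ((hβ.1.differentiableOn one_ne_zero r (Set.Ioo_subset_Icc_self hr)).hasDerivWithinAt).hasDerivAt
      (Icc_mem_nhds hr.1 hr.2)
  have hposb : ∀ r ∈ Set.Icc s t, IsStrictlyPositive (g * β r * g) := fun r hr =>
    (hpos r hr).conj hg hgu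
  obtain ⟨hint, heq⟩ := logIntegral_sub (b := fun r => g * β r * g) (b' := fun r => g * β' r * g)
    hst.le ((continuousOn_const.mul hβ.1.continuousOn).mul continuousOn_const)
    ((continuousOn_const.mul hcβ').mul continuousOn_const)
    (fun r hr => ((hderiv r hr).const_mul g).mul_const g) hposb
  rw [logIntegral_eq_log (hposb t ⟨hst.le, le_rfl⟩),
    logIntegral_eq_log (hposb s ⟨le_rfl, hst.le⟩)] at heq
  rw [← map_sub, ← heq, ← φ.intervalIntegral_comp_comm hint, intervalIntegral.integral_of_le hst.le]
  have hφint : IntegrableOn (fun r => φ (cfcLogDeriv (g * β r * g) (g * β' r * g)))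
      (Set.Ioc s t) :=
    φ.integrable_comp ((intervalIntegrable_iff_integrableOn_Ioc_of_le hst.le).1 hint)
  refine (ofReal_integral_le_lintegral hφint).trans ?_
  rw [← restrict_Ioo_eq_restrict_Ioc]
  refine setLIntegral_mono' measurableSet_Ioo fun r hr => ENNReal.ofReal_le_ofReal ?_
  have hrpos := hpos r (Set.Ioo_subset_Icc_self hr)
  have hsa : IsSelfAdjoint (β' r) := by
    refine (hderiv r hr).isSelfAdjoint_of_eventually ?_
    filter_upwards [Icc_mem_nhds hr.1 hr.2] with x hx using (hpos x hx).isSelfAdjoint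
  rw [(hderiv r hr).deriv, finslerNorm]
  set y := β r ^ (1 / 2 : ℝ) with hy
  set z := β r ^ (-(1 / 2) : ℝ) with hz
  have hyz : y * z = 1 := CFC.rpow_mul_rpow_neg _ hrpos
  have hzy : z * y = 1 := CFC.rpow_neg_mul_rpow _ hrpos
  have hysa : IsSelfAdjoint y := CFC.rpow_nonneg.isSelfAdjoint
  have hzsa : IsSelfAdjoint z := CFC.rpow_nonneg.isSelfAdjoint
  have hyu : IsUnit y := (hrpos.rpow _ _).isUnit
  have hgy := hgu.mul hyu
  have hT := hφ _ (isDoublyStochastic_logDerivConj hρ hgy) (z * β' r * z)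
    (by simpa [hzsa.star_eq] using hsa.conjugate z)
  have h1 : g * y * star (g * y) = g * β r * g := by
    rw [star_mul, hysa.star_eq, hg.star_eq, ← hrpos.rpow_half_mul_self]
    simp only [mul_assoc, hy]
  have h2 : g * y * (z * β' r * z) * star (g * y) = g * β' r * g := by
    rw [star_mul, hysa.star_eq, hg.star_eq]
    calc g * y * (z * β' r * z) * (y * g) = g * (y * z) * β' r * (z * y) * g := by
          simp only [mul_assoc]
      _ = g * β' r * g := by rw [hyz, hzy, mul_one, mul_one]
  change φ (cfcLogDeriv (g * y * star (g * y)) (g * y * (z * β' r * z) * star (g * y))) ≤ _ at hT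
  rwa [h1, h2] at hT

theorem ofReal_tracePNorm_log_le_finslerLength {τ : M →ₗ[ℂ] ℂ}
    (hτ : IsFaithfulNormalTracialState τ) {p : ℝ≥0∞} (hp : 1 ≤ p) {a b : M}
    (ha : IsStrictlyPositive a) {β : ℝ → M} (hβ : IsCurveJoining β a b) :
    ENNReal.ofReal (tracePNorm τ p (CFC.log (a ^ (-(1 / 2) : ℝ) * b * a ^ (-(1 / 2) : ℝ)))) ≤
      finslerLength τ p β := by
  obtain ⟨ρ, hρ, hρτ⟩ := hτ.exists_realTrace
  set g := a ^ (-(1 / 2) : ℝ) with hg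
  have hgsa : IsSelfAdjoint g := CFC.rpow_nonneg.isSelfAdjoint
  have hgu : IsUnit g := (ha.rpow _ _).isUnit
  refine ENNReal.le_of_forall_pos_le_add fun ε hε _ => ?_
  obtain ⟨φ, hφv, hφ⟩ := hρ.exists_dual hρτ hp (v := CFC.log (g * b * g)) .log
    (NNReal.coe_pos.2 hε)
  obtain ⟨n, s, hs0, hsn, hs⟩ := hβ.piecewiseSmooth.2
  have hmono : ∀ i ≤ n, ∀ j ≤ i, s j ≤ s i := by
    intro i
    induction i with
    | zero => intro _ j hj; rw [Nat.le_zero.1 hj]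
    | succ i ih =>
      intro hi j hj
      rcases Nat.le_succ_iff.1 hj with h | rfl
      · exact (ih (by omega) j h).trans (hs i (by omega)).1.le
      · exact le_rfl
  have key : ∀ k ≤ n, ENNReal.ofReal (φ (CFC.log (g * β (s k) * g))) ≤
      ∫⁻ r in Set.Ioc 0 (s k), ENNReal.ofReal (finslerNorm τ p (β r) (deriv β r)) := by
    intro k
    induction k with
    | zero =>
      intro _
      rw [hs0, hβ.left, CFC.conjugate_rpow_neg_one_half a ha, CFC.log_one]
      simp
    | succ k ih =>
      intro hk
      obtain ⟨hlt, hsm⟩ := hs k (by omega)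
      have h0 : 0 ≤ s k := hs0 ▸ hmono k (by omega) 0 (by omega)
      have h1 : s (k + 1) ≤ 1 := hsn ▸ hmono n le_rfl (k + 1) hk
      have hstep := ofReal_log_sub_log_le_lintegral hρ hφ hgsa hgu hlt hsm fun r hr =>
        hβ.mem_cone r ⟨h0.trans hr.1, hr.2.trans h1⟩
      rw [← Set.Ioc_union_Ioc_eq_Ioc h0 hlt.le,
        lintegral_union measurableSet_Ioc (Set.Ioc_disjoint_Ioc_of_le le_rfl)]
      refine le_trans ?_ (add_le_add (ih (by omega)) hstep)
      refine le_trans (le_of_eq ?_) ENNReal.ofReal_add_le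
      ring_nf
  have hfin := key n le_rfl
  rw [hsn, hβ.right] at hfin
  calc ENNReal.ofReal (tracePNorm τ p (CFC.log (g * b * g)))
      ≤ ENNReal.ofReal (φ (CFC.log (g * b * g)) + ε) :=
        ENNReal.ofReal_le_ofReal (by linarith)
    _ ≤ ENNReal.ofReal (φ (CFC.log (g * b * g))) + ENNReal.ofReal ε := ENNReal.ofReal_add_le
    _ ≤ finslerLength τ p β + ε := by
        rw [ENNReal.ofReal_coe_nnreal]
        gcongr
        exact hfin.trans (lintegral_mono_set Set.Ioc_subset_Icc_self)

end Length

section Geodesic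

open MeasureTheory

variable {M : Type*} [CStarAlgebra M] [PartialOrder M] [StarOrderedRing M]

theorem CFC.rpow_eq_exp_smul_log {c : M} (hc : IsStrictlyPositive c) (t : ℝ) :
    c ^ t = NormedSpace.exp (t • CFC.log c) := by
  have hne : ∀ x ∈ spectrum ℝ c, 0 < x := fun x hx =>
    (CStarAlgebra.isStrictlyPositive_iff_isSelfAdjoint_and_spectrum_pos.1 hc).2 x hx
  have hlog : ContinuousOn Real.log (spectrum ℝ c) :=
    Real.continuousOn_log.mono fun x hx => (hne x hx).ne'
  rw [CFC.rpow_eq_cfc_real hc.nonneg,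
    ← CFC.real_exp_eq_normedSpace_exp (IsSelfAdjoint.smul (.all t) .log), CFC.log,
    ← cfc_const_mul t Real.log c hlog,
    ← cfc_comp' Real.exp (fun x => t * Real.log x) c Real.continuous_exp.continuousOn
      (hlog.const_smul t)]
  refine cfc_congr fun x hx => ?_
  rw [Real.rpow_def_of_pos (hne x hx), mul_comm]

variable {τ : M →ₗ[ℂ] ℂ}

theorem IsFaithfulNormalTracialState.nontrivial (hτ : IsFaithfulNormalTracialState τ) :
    Nontrivial M := by
  refine ⟨1, 0, fun h => ?_⟩
  have := hτ.map_one
  rw [h, map_zero] at this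
  exact zero_ne_one this

theorem tracePNorm_neg (p : ℝ≥0∞) (x : M) : tracePNorm τ p (-x) = tracePNorm τ p x := by
  simp [tracePNorm]

theorem tracePNorm_smul_one (hτ : IsFaithfulNormalTracialState τ) {p : ℝ≥0∞} (hp : 1 ≤ p) (r : ℝ) :
    tracePNorm τ p (r • (1 : M)) = |r| := by
  have := hτ.nontrivial
  rw [tracePNorm]
  split_ifs with h
  · rw [norm_smul, CStarRing.norm_one, mul_one, Real.norm_eq_abs]
  · have hp0 : 0 < p.toReal := ENNReal.toReal_pos (zero_lt_one.trans_le hp).ne' h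
    obtain ⟨ρ, hρ, hρτ⟩ := hτ.exists_realTrace
    rw [CFC.abs_rpow_eq_cfc (IsSelfAdjoint.smul (.all r) (.one M)) hp0.le,
      ← Algebra.algebraMap_eq_smul_one, cfc_algebraMap, ← hρτ, Algebra.algebraMap_eq_smul_one,
      map_smul, hρ.map_one, smul_eq_mul, mul_one, one_div, Real.rpow_rpow_inv (abs_nonneg r) hp0.ne']

theorem tracePNorm_unitary_conj (hτ : IsFaithfulNormalTracialState τ) (p : ℝ≥0∞) {u v : M}
    (hu : u ∈ unitary M) (hv : IsSelfAdjoint v) :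
    tracePNorm τ p (u * v * star u) = tracePNorm τ p v := by
  rw [tracePNorm, tracePNorm]
  split_ifs with h
  · rw [CStarRing.norm_mul_mem_unitary _ (Unitary.star_mem hu), CStarRing.norm_mem_unitary_mul _ hu]
  · have hp0 : 0 ≤ p.toReal := ENNReal.toReal_nonneg
    have hv' : IsSelfAdjoint (u * v * star u) := hv.conjugate u
    rw [CFC.abs_rpow_eq_cfc hv' hp0, CFC.abs_rpow_eq_cfc hv hp0]
    have h1 : u * cfc (fun t : ℝ => |t| ^ p.toReal) v * star u =
        cfc (fun t : ℝ => |t| ^ p.toReal) (u * v * star u) := by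
      have hc : Continuous fun t : ℝ => |t| ^ p.toReal := by fun_prop (disch := assumption)
      exact StarAlgHomClass.map_cfc (S := ℝ) (Unitary.conjStarAlgAut ℝ M ⟨u, hu⟩)
        (fun t : ℝ => |t| ^ p.toReal) v hc.continuousOn
        (by change Continuous fun x => u * x * star u; fun_prop) hv hv'
    rw [← h1, hτ.map_mul_comm, ← mul_assoc, (Unitary.mem_iff.1 hu).1, one_mul]

theorem finslerNorm_conj (hτ : IsFaithfulNormalTracialState τ) (p : ℝ≥0∞) {q v : M}
    (hq : IsUnit q) (hv : IsSelfAdjoint v) :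
    finslerNorm τ p (q * star q) (q * v * star q) = tracePNorm τ p v := by
  have hx := hq.isStrictlyPositive_mul_star
  rw [finslerNorm]
  set z := (q * star q) ^ (-(1 / 2) : ℝ) with hz
  have hzsa : IsSelfAdjoint z := CFC.rpow_nonneg.isSelfAdjoint
  have hzu : IsUnit z := (hx.rpow _ _).isUnit
  have h1 : (z * q) * star (z * q) = 1 := by
    rw [star_mul, hzsa.star_eq, ← CFC.conjugate_rpow_neg_one_half _ hx]
    simp only [mul_assoc, hz]
  have h2 : star (z * q) * (z * q) = 1 := by
    obtain ⟨w, hw⟩ := hzu.mul hq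
    rw [← hw] at h1 ⊢
    exact congrArg Units.val (mul_eq_one_comm.1 (Units.ext h1 : w * star w = 1))
  rw [← tracePNorm_unitary_conj hτ p (Unitary.mem_iff.2 ⟨h2, h1⟩) hv, star_mul, hzsa.star_eq]
  simp only [mul_assoc]

section

variable {a b : M} (ha : IsStrictlyPositive a) (hb : IsStrictlyPositive b)
include ha hb

theorem isStrictlyPositive_conj_rpow_neg_half :
    IsStrictlyPositive (a ^ (-(1 / 2) : ℝ) * b * a ^ (-(1 / 2) : ℝ)) :=
  hb.conj CFC.rpow_nonneg.isSelfAdjoint (ha.rpow _ _).isUnit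

theorem coneGeodesic_eq_exp (t : ℝ) :
    coneGeodesic a b t = a ^ (1 / 2 : ℝ) * NormedSpace.exp
      (t • CFC.log (a ^ (-(1 / 2) : ℝ) * b * a ^ (-(1 / 2) : ℝ))) * a ^ (1 / 2 : ℝ) := by
  rw [coneGeodesic, CFC.rpow_eq_exp_smul_log (isStrictlyPositive_conj_rpow_neg_half ha hb)]

theorem isStrictlyPositive_coneGeodesic (t : ℝ) : IsStrictlyPositive (coneGeodesic a b t) :=
  ((isStrictlyPositive_conj_rpow_neg_half ha hb).rpow _ t).conj CFC.rpow_nonneg.isSelfAdjoint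
    (ha.rpow _ _).isUnit

theorem coneGeodesic_zero : coneGeodesic a b 0 = a := by
  rw [coneGeodesic, CFC.rpow_zero _ (isStrictlyPositive_conj_rpow_neg_half ha hb).nonneg, mul_one,
    ha.rpow_half_mul_self]

theorem coneGeodesic_one : coneGeodesic a b 1 = b := by
  have h1 := CFC.rpow_mul_rpow_neg (1 / 2) ha
  have h2 := CFC.rpow_neg_mul_rpow (1 / 2) ha
  rw [coneGeodesic, CFC.rpow_one _ (isStrictlyPositive_conj_rpow_neg_half ha hb).nonneg,
    ← mul_assoc, ← mul_assoc, h1, one_mul, mul_assoc, h2, mul_one]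

theorem hasDerivAt_coneGeodesic (t : ℝ) :
    HasDerivAt (coneGeodesic a b) (a ^ (1 / 2 : ℝ) *
      (CFC.log (a ^ (-(1 / 2) : ℝ) * b * a ^ (-(1 / 2) : ℝ)) * NormedSpace.exp
      (t • CFC.log (a ^ (-(1 / 2) : ℝ) * b * a ^ (-(1 / 2) : ℝ)))) * a ^ (1 / 2 : ℝ)) t := by
  rw [funext (coneGeodesic_eq_exp ha hb)]
  exact ((hasDerivAt_exp_smul_const' _ t).const_mul _).mul_const _

theorem contDiff_coneGeodesic : ContDiff ℝ 1 (coneGeodesic a b) := by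
  rw [contDiff_one_iff_deriv]
  refine ⟨fun t => (hasDerivAt_coneGeodesic ha hb t).differentiableAt, ?_⟩
  rw [funext fun t => (hasDerivAt_coneGeodesic ha hb t).deriv]
  have : Continuous fun t : ℝ => NormedSpace.exp
      (t • CFC.log (a ^ (-(1 / 2) : ℝ) * b * a ^ (-(1 / 2) : ℝ))) :=
    continuous_iff_continuousAt.2 fun t => (hasDerivAt_exp_smul_const' _ t).continuousAt
  fun_prop

theorem log_conj_rpow_neg_half_ne_zero (hab : a ≠ b) :
    CFC.log (a ^ (-(1 / 2) : ℝ) * b * a ^ (-(1 / 2) : ℝ)) ≠ 0 := by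
  intro h
  have h1 := coneGeodesic_eq_exp ha hb 1
  rw [coneGeodesic_one ha hb, h, smul_zero, NormedSpace.exp_zero, mul_one,
    ha.rpow_half_mul_self] at h1
  exact hab h1.symm

theorem isCurveJoining_coneGeodesic (hab : a ≠ b) :
    IsCurveJoining (coneGeodesic a b) a b where
  mem_cone t _ := isStrictlyPositive_coneGeodesic ha hb t
  left := coneGeodesic_zero ha hb
  right := coneGeodesic_one ha hb
  piecewiseSmooth := by
    have hcd := contDiff_coneGeodesic ha hb
    refine ⟨hcd.continuous.continuousOn, 1, fun i => i, Nat.cast_zero, Nat.cast_one,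
      fun i hi => ?_⟩
    obtain rfl : i = 0 := by omega
    simp only [Nat.cast_zero, zero_add, Nat.cast_one]
    refine ⟨zero_lt_one, hcd.contDiffOn, fun r hr => ?_⟩
    rw [(hasDerivAt_coneGeodesic ha hb r).hasDerivWithinAt.derivWithin
      (uniqueDiffOn_Icc zero_lt_one r hr)]
    have hu : IsUnit (a ^ (1 / 2 : ℝ)) := (ha.rpow _ _).isUnit
    rw [Ne, hu.mul_left_eq_zero, hu.mul_right_eq_zero,
      (IsSelfAdjoint.smul (.all r) .log).isStrictlyPositive_exp.isUnit.mul_left_eq_zero]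
    exact log_conj_rpow_neg_half_ne_zero ha hb hab

theorem finslerLength_coneGeodesic (hτ : IsFaithfulNormalTracialState τ) (p : ℝ≥0∞) :
    finslerLength τ p (coneGeodesic a b) = ENNReal.ofReal
      (tracePNorm τ p (CFC.log (a ^ (-(1 / 2) : ℝ) * b * a ^ (-(1 / 2) : ℝ)))) := by
  have hconst : ∀ t, finslerNorm τ p (coneGeodesic a b t) (deriv (coneGeodesic a b) t) =
      tracePNorm τ p (CFC.log (a ^ (-(1 / 2) : ℝ) * b * a ^ (-(1 / 2) : ℝ))) := by
    intro t
    rw [(hasDerivAt_coneGeodesic ha hb t).deriv, coneGeodesic_eq_exp ha hb]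
    set v := CFC.log (a ^ (-(1 / 2) : ℝ) * b * a ^ (-(1 / 2) : ℝ)) with hv
    have hvsa : IsSelfAdjoint v := .log
    set y := a ^ (1 / 2 : ℝ) with hy
    have hysa : IsSelfAdjoint y := CFC.rpow_nonneg.isSelfAdjoint
    set e := NormedSpace.exp ((t / 2) • v) with he
    have hee : NormedSpace.exp (t • v) = e * e := by
      let _ : NormedAlgebra ℚ M := .restrictScalars ℚ ℝ M
      rw [he, ← NormedSpace.exp_add_of_commute (Commute.refl _), ← add_smul, add_halves]
    have hesp : IsStrictlyPositive e := (IsSelfAdjoint.smul (.all _) hvsa).isStrictlyPositive_exp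
    have hve : v * e = e * v := ((Commute.refl v).smul_right (t / 2)).exp_right
    have h := finslerNorm_conj hτ p (((ha.rpow _ (1 / 2)).isUnit).mul hesp.isUnit) hvsa
    rw [star_mul, hysa.star_eq, hesp.isSelfAdjoint.star_eq] at h
    rw [← h, hee, ← mul_assoc v, hve]
    simp only [mul_assoc, hy]
  simp only [finslerLength, hconst]
  simp

end

omit [PartialOrder M] [StarOrderedRing M] in
theorem isSmoothCurveOn_of_eqOn_affine {γ : ℝ → M} {a : M} (ha : a ≠ 0) {s t k d : ℝ} (hst : s < t)
    (hd : d ≠ 0) (h : Set.EqOn γ (fun r => (k + d * r) • a) (Set.Icc s t)) :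
    IsSmoothCurveOn γ s t := by
  refine ⟨ContDiffOn.congr (by fun_prop) h, fun r hr => ?_⟩
  have hderiv : HasDerivAt (fun r : ℝ => (k + d * r) • a) ((d * 1) • a) r :=
    (((hasDerivAt_id r).const_mul d).const_add k).smul_const a
  rw [derivWithin_congr h (h hr), hderiv.hasDerivWithinAt.derivWithin (uniqueDiffOn_Icc hst r hr),
    mul_one]
  exact smul_ne_zero hd ha

/-- The curve that runs from `a` to `(1 + ε / 2) a` and back along a line. -/
noncomputable def tentCurve (ε : ℝ) (a : M) (t : ℝ) : M := (1 + ε * min t (1 - t)) • a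

omit [PartialOrder M] [StarOrderedRing M] in
theorem hasDerivAt_tentCurve (ε : ℝ) (a : M) {t : ℝ} (ht : t ≠ 1 / 2) :
    ∃ σ : ℝ, |σ| = 1 ∧ HasDerivAt (tentCurve ε a) ((ε * σ) • a) t := by
  rcases ht.lt_or_gt with h | h
  · refine ⟨1, abs_one, ?_⟩
    have h1 : HasDerivAt (fun t : ℝ => min t (1 - t)) 1 t := by
      refine (hasDerivAt_id t).congr_of_eventuallyEq ?_
      filter_upwards [Iio_mem_nhds h] with x hx
      exact min_eq_left (by linarith [Set.mem_Iio.1 hx])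
    exact ((h1.const_mul ε).const_add 1).smul_const a
  · refine ⟨-1, by simp, ?_⟩
    have h1 : HasDerivAt (fun t : ℝ => min t (1 - t)) (-1) t := by
      refine ((hasDerivAt_id t).const_sub 1).congr_of_eventuallyEq ?_
      filter_upwards [Ioi_mem_nhds h] with x hx
      exact min_eq_right (by linarith [Set.mem_Ioi.1 hx])
    exact ((h1.const_mul ε).const_add 1).smul_const a

theorem isCurveJoining_tentCurve [Nontrivial M] {ε : ℝ} (hε : 0 < ε) {a : M}
    (ha : IsStrictlyPositive a) : IsCurveJoining (tentCurve ε a) a a where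
  mem_cone t ht := by
    have : 0 ≤ min t (1 - t) := le_min ht.1 (by linarith [ht.2])
    exact IsStrictlyPositive.smul (by positivity) ha
  left := by simp [tentCurve]
  right := by simp [tentCurve]
  piecewiseSmooth := by
    have hc : Continuous (tentCurve ε a) := by
      unfold tentCurve
      fun_prop
    have ha0 : a ≠ 0 := ha.isUnit.ne_zero
    refine ⟨hc.continuousOn, 2, fun i => i / 2, by simp, by simp, fun i hi => ?_⟩
    rcases (by omega : i = 0 ∨ i = 1) with rfl | rfl
    · refine ⟨by norm_num, isSmoothCurveOn_of_eqOn_affine ha0 (k := 1) (d := ε) (by norm_num)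
        hε.ne' fun r hr => ?_⟩
      norm_num at hr
      simp only [tentCurve]
      rw [min_eq_left (by linarith)]
    · refine ⟨by norm_num, isSmoothCurveOn_of_eqOn_affine ha0 (k := 1 + ε) (d := -ε) (by norm_num)
        (neg_ne_zero.2 hε.ne') fun r hr => ?_⟩
      norm_num at hr
      simp only [tentCurve]
      rw [min_eq_right (by linarith)]
      ring_nf

theorem finslerNorm_smul_smul (hτ : IsFaithfulNormalTracialState τ) {p : ℝ≥0∞} (hp : 1 ≤ p) {a : M}
    (ha : IsStrictlyPositive a) {c : ℝ} (hc : 0 < c) (r : ℝ) :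
    finslerNorm τ p (c • a) (r • a) = |r / c| := by
  have hysa : IsSelfAdjoint (a ^ (1 / 2 : ℝ)) := CFC.rpow_nonneg.isSelfAdjoint
  have hq : IsUnit (√c • a ^ (1 / 2 : ℝ)) :=
    (IsStrictlyPositive.smul (Real.sqrt_pos.2 hc) (ha.rpow _ _)).isUnit
  have h := finslerNorm_conj hτ p hq (IsSelfAdjoint.smul (.all (r / c)) (.one M))
  rw [tracePNorm_smul_one hτ hp, star_smul, hysa.star_eq, star_trivial] at h
  simp only [mul_smul_comm, smul_mul_assoc, mul_one, ha.rpow_half_mul_self,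
    Real.mul_self_sqrt hc.le, smul_smul] at h
  rw [← h, mul_left_comm, Real.mul_self_sqrt hc.le, div_mul_cancel₀ _ hc.ne']

/-- Short loops at `a` show that the distance of `a` to itself vanishes. -/
theorem finslerDist_self (hτ : IsFaithfulNormalTracialState τ) {p : ℝ≥0∞} (hp : 1 ≤ p) {a : M}
    (ha : IsStrictlyPositive a) : finslerDist τ p a a = 0 := by
  have := hτ.nontrivial
  refine nonpos_iff_eq_zero.1 (ENNReal.le_of_forall_pos_le_add fun ε hε _ => ?_)
  rw [zero_add]
  refine (iInf₂_le (f := fun γ (_ : IsCurveJoining γ a a) => finslerLength τ p γ) _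
    (isCurveJoining_tentCurve (NNReal.coe_pos.2 hε) ha)).trans ?_
  have hne : ∀ᵐ t : ℝ, t ≠ 1 / 2 := by
    rw [ae_iff]
    simp
  calc finslerLength τ p (tentCurve ε a) ≤ ∫⁻ _ in Set.Icc (0 : ℝ) 1, ε := by
        refine lintegral_mono_ae ?_
        filter_upwards [ae_restrict_mem measurableSet_Icc, ae_restrict_of_ae hne] with t ht ht'
        obtain ⟨σ, hσ, hd⟩ := hasDerivAt_tentCurve ε a ht'
        have h0 : 0 ≤ ε * min t (1 - t) := mul_nonneg ε.2 (le_min ht.1 (by linarith [ht.2]))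
        have hc : 0 < 1 + ε * min t (1 - t) := by linarith
        rw [hd.deriv, tentCurve, finslerNorm_smul_smul hτ hp ha hc, ← ENNReal.ofReal_coe_nnreal]
        refine ENNReal.ofReal_le_ofReal ?_
        rw [abs_div, abs_mul, hσ, mul_one, abs_of_pos hc, NNReal.abs_eq]
        exact div_le_self ε.2 (by linarith)
    _ = ε := by simp

theorem finslerDist_eq (hτ : IsFaithfulNormalTracialState τ) {p : ℝ≥0∞} (hp : 1 ≤ p) {a b : M}
    (ha : IsStrictlyPositive a) (hb : IsStrictlyPositive b) :
    finslerDist τ p a b = ENNReal.ofReal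
      (tracePNorm τ p (CFC.log (a ^ (-(1 / 2) : ℝ) * b * a ^ (-(1 / 2) : ℝ)))) := by
  rcases eq_or_ne a b with rfl | hab
  · rw [finslerDist_self hτ hp ha, CFC.conjugate_rpow_neg_one_half a ha, CFC.log_one,
      ← zero_smul ℝ (1 : M), tracePNorm_smul_one hτ hp]
    simp
  · refine le_antisymm ?_ (le_iInf₂ fun β hβ => ofReal_tracePNorm_log_le_finslerLength hτ hp ha hβ)
    rw [← finslerLength_coneGeodesic ha hb hτ]
    exact iInf₂_le (f := fun γ (_ : IsCurveJoining γ a b) => finslerLength τ p γ) _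
      (isCurveJoining_coneGeodesic ha hb hab)

theorem log_exp_conj {v w : M} (hv : IsSelfAdjoint v) (hw : IsSelfAdjoint w) :
    CFC.log (NormedSpace.exp ((1 / 2 : ℝ) • v) * NormedSpace.exp (-w) *
      NormedSpace.exp ((1 / 2 : ℝ) • v)) =
    -CFC.log (NormedSpace.exp v ^ (-(1 / 2) : ℝ) * NormedSpace.exp w *
      NormedSpace.exp v ^ (-(1 / 2) : ℝ)) := by
  let _ : NormedAlgebra ℚ M := .restrictScalars ℚ ℝ M
  have hc := isStrictlyPositive_conj_rpow_neg_half hv.isStrictlyPositive_exp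
    hw.isStrictlyPositive_exp
  rw [CFC.rpow_eq_exp_smul_log hv.isStrictlyPositive_exp, CFC.log_exp v hv, neg_smul] at hc ⊢
  set c := NormedSpace.exp (-((1 / 2 : ℝ) • v)) * NormedSpace.exp w *
    NormedSpace.exp (-((1 / 2 : ℝ) • v)) with hcdef
  have hexp : ∀ x : M, NormedSpace.exp x * NormedSpace.exp (-x) = 1 := fun x => by
    rw [← NormedSpace.exp_add_of_commute (Commute.refl x).neg_right, add_neg_cancel,
      NormedSpace.exp_zero]
  have hexp' : ∀ x : M, NormedSpace.exp (-x) * NormedSpace.exp x = 1 := fun x => by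
    simpa using hexp (-x)
  set x := NormedSpace.exp ((1 / 2 : ℝ) • v) * NormedSpace.exp (-w) *
    NormedSpace.exp ((1 / 2 : ℝ) • v) with hx
  have hxc : x * c = 1 := by
    calc x * c = NormedSpace.exp ((1 / 2 : ℝ) • v) * (NormedSpace.exp (-w) *
          (NormedSpace.exp ((1 / 2 : ℝ) • v) * NormedSpace.exp (-((1 / 2 : ℝ) • v))) *
          NormedSpace.exp w) * NormedSpace.exp (-((1 / 2 : ℝ) • v)) := by
          simp only [hx, hcdef, mul_assoc]
      _ = 1 := by rw [hexp, mul_one, hexp', mul_one, hexp]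
  have hxe : x = NormedSpace.exp (-CFC.log c) := by
    have h1 := hexp (CFC.log c)
    rw [CFC.exp_log c hc] at h1
    exact left_inv_eq_right_inv hxc h1
  rw [hxe, CFC.log_exp _ (IsSelfAdjoint.neg .log)]

end Geodesic

theorem mainTheorem1 {M : Type*} [CStarAlgebra M] [PartialOrder M] [StarOrderedRing M]
    [WStarAlgebra M] (τ : M →ₗ[ℂ] ℂ) (hτ : IsFaithfulNormalTracialState τ)
    (p : ℝ≥0∞) (hp : 1 ≤ p) :
    (∀ a b : M, IsStrictlyPositive a → IsStrictlyPositive b →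
      (∀ t : ℝ, IsStrictlyPositive (coneGeodesic a b t)) ∧
      coneGeodesic a b 0 = a ∧ coneGeodesic a b 1 = b ∧
      ContDiff ℝ 1 (coneGeodesic a b) ∧
      (a ≠ b → IsCurveJoining (coneGeodesic a b) a b) ∧
      ∀ β : ℝ → M, IsCurveJoining β a b →
        finslerLength τ p (coneGeodesic a b) ≤ finslerLength τ p β) ∧
    (∀ v w : M, IsSelfAdjoint v → IsSelfAdjoint w →
      finslerDist τ p (NormedSpace.exp v) (NormedSpace.exp w) =
        ENNReal.ofReal (tracePNorm τ p (CFC.log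
          (NormedSpace.exp ((1 / 2 : ℝ) • v) * NormedSpace.exp (-w) *
            NormedSpace.exp ((1 / 2 : ℝ) • v))))) := by
  refine ⟨fun a b ha hb => ⟨isStrictlyPositive_coneGeodesic ha hb, coneGeodesic_zero ha hb,
    coneGeodesic_one ha hb, contDiff_coneGeodesic ha hb, isCurveJoining_coneGeodesic ha hb,
    fun β hβ => ?_⟩, fun v w hv hw => ?_⟩
  · rw [finslerLength_coneGeodesic ha hb hτ]
    exact ofReal_tracePNorm_log_le_finslerLength hτ hp ha hβ
  · rw [log_exp_conj hv hw, tracePNorm_neg,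
      finslerDist_eq hτ hp hv.isStrictlyPositive_exp hw.isStrictlyPositive_exp]
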